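/- Let $p\in[0,1]$ be such that $a:=2p-1>\tfrac12$. Consider the one-dimensional elephant random walk $(S_n)_{n\ge 0}$ with memory parameter $p$ whose first step is to the right: $S_0=0$, $S_{n+1}=S_n+X_{n+1}$, where $X_1=1$ and, for every $n\ge 1$, $X_{n+1}=\varepsilon_n X_{\kappa_n}$ with $\kappa_n$ uniformly distributed on $\{1,\dots,n\}$ and $\mathbb P(\varepsilon_n=1)=p=1-\mathbb P(\varepsilon_n=-1)$, the variables $\kappa_n$ and $\varepsilon_n$ being independent of each other and of $(X_1,\dots,X_n)$. Then the limit $$L_1=\lim_{n\to\infty}\frac{S_n}{n^{a}}$$ exists almost surely, and its distribution satisfies the fixed-point equation $$L_1\overset{\mathcal L}{=}V^{a}L_1^{(1)}+(2\xi_p-1)(1-V)^{a}L_1^{(2)},$$ where $V$ is uniformly distributed on $[0,1]$, $\xi_p$ is a Bernoulli random variable with parameter $p$, the variables $L_1^{(1)}$ and $L_1^{(2)}$ have the same distribution as $L_1$, and $V,\xi_p,L_1^{(1)},L_1^{(2)}$ are mutually independent. -/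

import Mathlib

open MeasureTheory ProbabilityTheory Filter Topology
open scoped unitInterval

/-- `X 1, X 2, …` are the successive steps of a one-dimensional elephant random walk with memory
parameter `p` and first step parameter `q` (the value `X 0` plays no role).
For `n ≥ 1`, `κ n` is the past time that the elephant remembers when it performs step `n + 1`, and
`ε n` is `+1` or `-1` according to whether it repeats or reverses the remembered step. -/
structure IsElephantWalk {Ω : Type*} [MeasurableSpace Ω] (P : Measure Ω) (p q : I)
    (X : ℕ → Ω → ℝ) (κ : ℕ → Ω → ℕ) (ε : ℕ → Ω → ℝ) : Prop where
  /-- The first step is `+1` with probability `q` and `-1` with probability `1 - q`. -/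
  first_step : HasLaw (X 1) (bernoulliMeasure (1 : ℝ) (-1) q) P
  /-- The remembered time is uniform on `{1, …, n}`. -/
  time_law : ∀ n, 1 ≤ n → HasLaw (κ n) (uniformOn (Set.Icc 1 n)) P
  /-- The sign is `+1` with probability `p` and `-1` with probability `1 - p`. -/
  sign_law : ∀ n, 1 ≤ n → HasLaw (ε n) (bernoulliMeasure (1 : ℝ) (-1) p) P
  /-- The remembered time and the sign are independent of each other … -/
  indep_time_sign : ∀ n, 1 ≤ n → IndepFun (κ n) (ε n) P
  /-- … and, jointly, of the steps `X 1, …, X n` made so far. -/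
  indep_past : ∀ n, 1 ≤ n →
    IndepFun (fun ω => (κ n ω, ε n ω)) (fun ω (i : Fin n) => X (i + 1) ω) P
  step : ∀ n, 1 ≤ n → ∀ᵐ ω ∂P, X (n + 1) ω = ε n ω * X (κ n ω) ω

/-- The position `S n = X 1 + ⋯ + X n` at time `n` of a walk with steps `X` started at `0`. -/
def walkPosition {Ω : Type*} (X : ℕ → Ω → ℝ) (n : ℕ) (ω : Ω) : ℝ :=
  ∑ k ∈ Finset.Icc 1 n, X k ω

/-- `L` is the almost sure limit of `S n / n ^ a`, where `S` is the walk with steps `X`. -/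
def IsScalingLimit {Ω : Type*} [MeasurableSpace Ω] (P : Measure Ω) (X : ℕ → Ω → ℝ) (a : ℝ)
    (L : Ω → ℝ) : Prop :=
  ∀ᵐ ω ∂P, Tendsto (fun n : ℕ => walkPosition X n ω / (n : ℝ) ^ a) atTop (𝓝 (L ω))

/-! Both halves rest on `integral_step_smul`: conditionally on the past, the next step has mean `a /
n` times the position.

Existence: dividing `S (n + 1)` by `growthFactor a n` gives a martingale. It is bounded in L²
because the inverse squares of the growth factors are summable for `a > 1/2`, so it converges almost
surely. Euler's limit for the Gamma function compares `growthFactor a n` with a multiple of `n ^ a`.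

Fixed point: the equation already holds in a discrete form at finite times. In the recursive tree
where each step is attached to the step it recalls, the subtree of step 2 has uniform size and
carries a walk independent of the rest, with sign `±1` of probabilities `p` and `1 - p`. The tree is
not built here: the identity is proved for characteristic functions. Since steps are `±1`, these
satisfy a recursion involving their derivative (`walkCharFun_succ`), and
`convolution_identity_of_recursion` derives the mixture formula from it by induction. Evaluating at
`t / (m + 1) ^ a` turns the average over the size into an integral over `v`
(`charFun_scalingLimit`), which is the characteristic function of the right-hand side
(`charFun_uniform_mixture`). Uniqueness of characteristic functions concludes. -/

/-! ### Steps, positions and the conditional mean of the next step. -/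

lemma walkPosition_eq_sum_fin {Ω : Type*} (X : ℕ → Ω → ℝ) (n : ℕ) (ω : Ω) :
    walkPosition X n ω = ∑ i : Fin n, X (i + 1) ω := by
  rw [Fin.sum_univ_eq_sum_range (fun i => X (i + 1) ω), Finset.range_eq_Ico,
    Finset.sum_Ico_add' (fun i => X i ω) 0 n 1]
  rfl

lemma walkPosition_succ {Ω : Type*} (X : ℕ → Ω → ℝ) (n : ℕ) (ω : Ω) :
    walkPosition X (n + 1) ω = walkPosition X n ω + X (n + 1) ω := by
  simp [walkPosition, Finset.sum_Icc_succ_top]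

lemma walkPosition_one {Ω : Type*} (X : ℕ → Ω → ℝ) (ω : Ω) :
    walkPosition X 1 ω = X 1 ω := by
  simp [walkPosition]

lemma ae_bernoulliMeasure_eq_or_eq {α : Type*} [MeasurableSpace α] [MeasurableSingletonClass α]
    (x y : α) (p : I) : ∀ᵐ z ∂bernoulliMeasure x y p, z = x ∨ z = y := by
  have hm : MeasurableSet ({x, y} : Set α) := (Set.toFinite _).measurableSet
  exact (ae_iff_prob_eq_one (p := (· ∈ ({x, y} : Set α))) hm.mem).2
    (bernoulliMeasure_apply_of_mem_of_mem _ hm (by simp) (by simp))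

namespace IsElephantWalk

variable {Ω : Type*} [MeasurableSpace Ω] {P : Measure Ω} {p q : I}
  {X : ℕ → Ω → ℝ} {κ : ℕ → Ω → ℕ} {ε : ℕ → Ω → ℝ}

lemma ae_time_mem (hX : IsElephantWalk P p q X κ ε) {n : ℕ} (hn : 1 ≤ n) :
    ∀ᵐ ω ∂P, κ n ω ∈ Set.Icc 1 n := by
  rw [(hX.time_law n hn).ae_iff (p := (· ∈ Set.Icc 1 n)) (by fun_prop)]
  have := isProbabilityMeasure_uniformOn (Set.finite_Icc 1 n) ⟨1, Set.mem_Icc.2 ⟨le_rfl, hn⟩⟩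
  rw [ae_iff_prob_eq_one (by fun_prop)]
  exact uniformOn_self (Set.finite_Icc 1 n) ⟨1, Set.mem_Icc.2 ⟨le_rfl, hn⟩⟩

lemma ae_sign (hX : IsElephantWalk P p q X κ ε) {n : ℕ} (hn : 1 ≤ n) :
    ∀ᵐ ω ∂P, ε n ω = 1 ∨ ε n ω = -1 := by
  have hm : MeasurableSet {x : ℝ | x = 1 ∨ x = -1} := by measurability
  rw [(hX.sign_law n hn).ae_iff (p := fun x => x = 1 ∨ x = -1) hm.mem]
  exact ae_bernoulliMeasure_eq_or_eq _ _ _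

/-- Splitting over the value of `κ n` removes the random index: each term is a function of `(κ n, ε
n)` times a function of the past, so that measurability and independence apply termwise. -/
lemma ae_step_eq_sum (hX : IsElephantWalk P p q X κ ε) {n : ℕ} (hn : 1 ≤ n) :
    ∀ᵐ ω ∂P, X (n + 1) ω =
      ∑ i : Fin n, (ε n ω * if κ n ω = i + 1 then 1 else 0) * X (i + 1) ω := by
  filter_upwards [hX.step n hn, hX.ae_time_mem hn] with ω h1 h2
  rw [h1, Fin.sum_univ_eq_sum_range
    (fun i => (ε n ω * if κ n ω = i + 1 then 1 else 0) * X (i + 1) ω),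
    Finset.sum_eq_single (κ n ω - 1)]
  · simp [Nat.sub_add_cancel h2.1]
  · intro b _ hb
    have : κ n ω ≠ b + 1 := by omega
    simp [this]
  · intro h
    have := h2.1
    have := h2.2
    simp only [Finset.mem_range] at h
    omega

lemma aemeasurable_time_sign (hX : IsElephantWalk P p q X κ ε) {n : ℕ} (hn : 1 ≤ n) :
    AEMeasurable (fun ω => (κ n ω, ε n ω)) P :=
  (hX.time_law n hn).aemeasurable.prodMk (hX.sign_law n hn).aemeasurable

lemma measurable_recall (j : ℕ) :
    Measurable (fun z : ℕ × ℝ => z.2 * if z.1 = j then (1 : ℝ) else 0) :=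
  measurable_snd.mul (Measurable.ite (measurable_fst (measurableSet_singleton j))
    measurable_const measurable_const)

lemma aemeasurable_step (hX : IsElephantWalk P p q X κ ε) {n : ℕ} (hn : 1 ≤ n) :
    AEMeasurable (X n) P := by
  induction n using Nat.strong_induction_on with
  | _ n ih =>
    rcases Nat.lt_or_ge n 2 with h | h
    · obtain rfl : n = 1 := by omega
      exact hX.first_step.aemeasurable
    · obtain ⟨m, rfl⟩ : ∃ m, n = m + 1 := ⟨n - 1, by omega⟩
      have hm : 1 ≤ m := by omega
      refine AEMeasurable.congr ?_ (EventuallyEq.symm (hX.ae_step_eq_sum hm))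
      refine Finset.aemeasurable_fun_sum _ fun i _ => ?_
      exact ((measurable_recall (i + 1)).comp_aemeasurable (hX.aemeasurable_time_sign hm)).mul
        (ih _ (by omega) (by omega))

lemma ae_abs_step (hX : IsElephantWalk P p q X κ ε) {n : ℕ} (hn : 1 ≤ n) :
    ∀ᵐ ω ∂P, X n ω = 1 ∨ X n ω = -1 := by
  induction n using Nat.strong_induction_on with
  | _ n ih =>
    rcases Nat.lt_or_ge n 2 with h | h
    · obtain rfl : n = 1 := by omega
      have hm : MeasurableSet {x : ℝ | x = 1 ∨ x = -1} := by measurability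
      rw [hX.first_step.ae_iff (p := fun x => x = 1 ∨ x = -1) hm.mem]
      exact ae_bernoulliMeasure_eq_or_eq _ _ _
    · obtain ⟨m, rfl⟩ : ∃ m, n = m + 1 := ⟨n - 1, by omega⟩
      have hm : 1 ≤ m := by omega
      have hall : ∀ᵐ ω ∂P, ∀ i : Fin m, X (i + 1) ω = 1 ∨ X (i + 1) ω = -1 :=
        ae_all_iff.2 fun i => ih _ (by omega) (by omega)
      filter_upwards [hX.step m hm, hX.ae_time_mem hm, hX.ae_sign hm, hall] with ω h1 h2 h3 h4
      have := h4 ⟨κ m ω - 1, by have := h2.1; have := h2.2; omega⟩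
      simp only [Nat.sub_add_cancel h2.1] at this
      rw [h1]
      rcases h3 with h3 | h3 <;> rcases this with h | h <;> simp [h3, h]

lemma aemeasurable_past (hX : IsElephantWalk P p q X κ ε) (n : ℕ) :
    AEMeasurable (fun ω (i : Fin n) => X (i + 1) ω) P :=
  aemeasurable_pi_lambda _ fun i => hX.aemeasurable_step (by omega)

lemma aemeasurable_walkPosition (hX : IsElephantWalk P p q X κ ε) (n : ℕ) :
    AEMeasurable (walkPosition X n) P :=
  Finset.aemeasurable_fun_sum _ fun _ hi => hX.aemeasurable_step (Finset.mem_Icc.1 hi).1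

lemma ae_abs_walkPosition_le (hX : IsElephantWalk P p q X κ ε) (n : ℕ) :
    ∀ᵐ ω ∂P, |walkPosition X n ω| ≤ n := by
  have hall : ∀ᵐ ω ∂P, ∀ i : Fin n, X (i + 1) ω = 1 ∨ X (i + 1) ω = -1 :=
    ae_all_iff.2 fun i => hX.ae_abs_step (by omega)
  filter_upwards [hall] with ω h
  rw [walkPosition_eq_sum_fin]
  refine (Finset.abs_sum_le_sum_abs _ _).trans ?_
  refine (Finset.sum_le_card_nsmul _ _ 1 fun i _ => ?_).trans (by simp)
  rcases h i with h | h <;> simp [h]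

lemma integral_recall (hX : IsElephantWalk P p q X κ ε) {n : ℕ} (hn : 1 ≤ n) (i : Fin n) :
    ∫ ω, (ε n ω * if κ n ω = i + 1 then 1 else 0) ∂P = (2 * (p : ℝ) - 1) / n := by
  have hind : IndepFun (ε n) (fun ω => if κ n ω = (i : ℕ) + 1 then (1 : ℝ) else 0) P :=
    (hX.indep_time_sign n hn).symm.comp (φ := id) (ψ := fun k => if k = (i : ℕ) + 1 then (1 : ℝ) else 0)
      measurable_id (by fun_prop)
  have hκ := (hX.time_law n hn)
  have hmeas : Measurable fun k : ℕ => if k = i + 1 then (1 : ℝ) else 0 := by fun_prop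
  have hε : ∫ ω, ε n ω ∂P = 2 * (p : ℝ) - 1 := by
    rw [(hX.sign_law n hn).integral_eq, integral_bernoulliMeasure]
    simp only [smul_eq_mul]
    ring
  have hi : ∫ ω, (if κ n ω = i + 1 then (1 : ℝ) else 0) ∂P = 1 / n := by
    have h1 := hκ.integral_comp hmeas.aestronglyMeasurable
    have h2 : (fun k : ℕ => if k = i + 1 then (1 : ℝ) else 0) =
        Set.indicator ({(i : ℕ) + 1} : Set ℕ) 1 := by
      ext k; simp [Set.indicator_apply]
    rw [h2, integral_indicator_one (measurableSet_singleton _), measureReal_def] at h1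
    have h3 := uniformOn_apply_finset (s := Finset.Icc 1 n) (t := {(i : ℕ) + 1})
    rw [Finset.inter_singleton_of_mem (Finset.mem_Icc.2 ⟨by omega, by omega⟩)] at h3
    simp only [Finset.coe_Icc, Finset.coe_singleton, Finset.card_singleton, Nat.card_Icc,
      Nat.add_sub_cancel] at h3
    rw [h3] at h1
    rw [← h2] at h1
    simpa [Function.comp_def] using h1
  rw [hind.integral_fun_mul_eq_mul_integral (hX.sign_law n hn).aemeasurable.aestronglyMeasurable
    (hmeas.comp_aemeasurable hκ.aemeasurable).aestronglyMeasurable, hε, hi]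
  ring

/-- Given the past, the expected next step is `(2p - 1) / n` times the current position. -/
lemma integral_step_smul (hX : IsElephantWalk P p q X κ ε) {n : ℕ} (hn : 1 ≤ n)
    {E : Type*} [NormedAddCommGroup E] [NormedSpace ℝ E] {g : (Fin n → ℝ) → E}
    (hg : StronglyMeasurable g) (hint : Integrable (fun ω => g fun i => X (i + 1) ω) P) :
    ∫ ω, X (n + 1) ω • g (fun i => X (i + 1) ω) ∂P =
      ((2 * (p : ℝ) - 1) / n) •
        ∫ ω, walkPosition X n ω • g (fun i => X (i + 1) ω) ∂P := by
  set G : Ω → E := fun ω => g fun i => X (i + 1) ω with hG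
  have hXG : ∀ i : Fin n, Integrable (fun ω => X (i + 1) ω • G ω) P := fun i => by
    refine hint.bdd_smul 1 (hX.aemeasurable_step (by omega)).aestronglyMeasurable ?_
    filter_upwards [hX.ae_abs_step (n := i + 1) (by omega)] with ω h
    rcases h with h | h <;> simp [h]
  have hterm : ∀ i : Fin n,
      Integrable (fun ω => (ε n ω * if κ n ω = i + 1 then 1 else 0) • (X (i + 1) ω • G ω)) P := by
    intro i
    refine (hXG i).bdd_smul 1 ((measurable_recall (i + 1)).comp_aemeasurable
      (hX.aemeasurable_time_sign hn)).aestronglyMeasurable ?_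
    filter_upwards [hX.ae_sign hn] with ω h
    rcases h with h | h <;> simp [h] <;> split_ifs <;> simp
  calc ∫ ω, X (n + 1) ω • G ω ∂P
      = ∫ ω, ∑ i : Fin n,
          (ε n ω * if κ n ω = i + 1 then 1 else 0) • (X (i + 1) ω • G ω) ∂P := by
        refine integral_congr_ae ?_
        filter_upwards [hX.ae_step_eq_sum hn] with ω h
        rw [h, Finset.sum_smul]
        simp only [smul_smul]
    _ = ∑ i : Fin n, ∫ ω,
          (ε n ω * if κ n ω = i + 1 then 1 else 0) • (X (i + 1) ω • G ω) ∂P :=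
        integral_finsetSum _ fun i _ => hterm i
    _ = ∑ i : Fin n, ((2 * (p : ℝ) - 1) / n) • ∫ ω, X (i + 1) ω • G ω ∂P := by
        refine Finset.sum_congr rfl fun i _ => ?_
        rw [← hX.integral_recall hn i]
        exact (hX.indep_past n hn).integral_fun_comp_smul_comp
          (f := fun z : ℕ × ℝ => z.2 * if z.1 = i + 1 then (1 : ℝ) else 0)
          (g := fun x : Fin n → ℝ => x i • g x) (hX.aemeasurable_time_sign hn)
          (hX.aemeasurable_past n) (measurable_recall (i + 1)).aestronglyMeasurable
          ((measurable_pi_apply i).stronglyMeasurable.smul hg).aestronglyMeasurable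
    _ = _ := by
        rw [← Finset.smul_sum, ← integral_finsetSum _ fun i _ => hXG i]
        simp only [walkPosition_eq_sum_fin, Finset.sum_smul, hG]

variable [IsProbabilityMeasure P]

lemma integrable_walkPosition (hX : IsElephantWalk P p q X κ ε) (n : ℕ) :
    Integrable (walkPosition X n) P :=
  .of_bound (hX.aemeasurable_walkPosition n).aestronglyMeasurable n
    (by simpa using hX.ae_abs_walkPosition_le n)

end IsElephantWalk

/-! ### Asymptotics of the growth factor. -/

/-- The factor `∏ (1 + a / k)`, `1 ≤ k ≤ n`, by which the expected position of the walk grows. -/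
noncomputable def growthFactor (a : ℝ) (n : ℕ) : ℝ :=
  ∏ k ∈ Finset.range n, (1 + a / (k + 1))

lemma growthFactor_succ (a : ℝ) (n : ℕ) :
    growthFactor a (n + 1) = growthFactor a n * (1 + a / (n + 1)) :=
  Finset.prod_range_succ _ _

lemma growthFactor_pos {a : ℝ} (ha : 0 < a) (n : ℕ) : 0 < growthFactor a n :=
  Finset.prod_pos fun _ _ => by positivity

/-- Euler's sequence is `n ^ a * n! / (a (a + 1) ⋯ (a + n))`; without the factor `a`, the
denominator is `n!` times the growth factor. -/
lemma rpow_div_growthFactor {a : ℝ} (ha : 0 < a) (n : ℕ) :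
    (n : ℝ) ^ a / growthFactor a n = a * Real.GammaSeq a n := by
  have h1 : growthFactor a n * n.factorial = ∏ k ∈ Finset.range n, (a + (k + 1 : ℕ)) := by
    rw [← Finset.prod_range_add_one_eq_factorial, growthFactor, Nat.cast_prod,
      ← Finset.prod_mul_distrib]
    refine Finset.prod_congr rfl fun k _ => ?_
    push_cast
    field_simp
    ring
  have h2 := growthFactor_pos ha n
  have h3 : (0 : ℝ) < n.factorial := by positivity
  rw [Real.GammaSeq, Finset.prod_range_succ', ← h1]
  push_cast
  field_simp
  ring

lemma tendsto_rpow_div_growthFactor {a : ℝ} (ha : 0 < a) :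
    Tendsto (fun n : ℕ => (n : ℝ) ^ a / growthFactor a n) atTop (𝓝 (a * Real.Gamma a)) := by
  simp_rw [rpow_div_growthFactor ha]
  exact (Real.GammaSeq_tendsto_Gamma a).const_mul a

lemma tendsto_growthFactor_div_rpow {a : ℝ} (ha : 0 < a) :
    Tendsto (fun n : ℕ => growthFactor a n / ((n + 1 : ℕ) : ℝ) ^ a) atTop
      (𝓝 (a * Real.Gamma a)⁻¹) := by
  have hne : a * Real.Gamma a ≠ 0 := (mul_pos ha (Real.Gamma_pos_of_pos ha)).ne'
  have h1 := (tendsto_rpow_div_growthFactor ha).inv₀ hne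
  have h2 : Tendsto (fun n : ℕ => ((n : ℝ) / (n + 1)) ^ a) atTop (𝓝 (1 ^ a)) :=
    (tendsto_natCast_div_add_atTop (1 : ℝ)).rpow_const (Or.inl one_ne_zero)
  rw [Real.one_rpow] at h2
  have h3 := h1.mul h2
  rw [mul_one] at h3
  refine h3.congr' ?_
  filter_upwards [eventually_gt_atTop 0] with n hn
  have hn' : (0 : ℝ) < n := by exact_mod_cast hn
  have := growthFactor_pos ha n
  rw [Real.div_rpow (by positivity) (by positivity)]
  push_cast
  have : (n : ℝ) ^ a ≠ 0 := by positivity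
  field_simp

/-- The terms are of order `n ^ (-2a)`. This is where superdiffusivity is essential; the rest needs
only `0 < a`. -/
lemma summable_inv_growthFactor_sq {a : ℝ} (ha : 1 / 2 < a) :
    Summable fun n : ℕ => (growthFactor a n ^ 2)⁻¹ := by
  have ha0 : 0 < a := by linarith
  refine summable_of_isBigO_nat (Real.summable_nat_rpow.2 (by linarith : -(2 * a) < -1)) ?_
  have h1 := ((tendsto_rpow_div_growthFactor ha0).pow 2).isBigO_one ℝ
  have h2 := h1.mul (Asymptotics.isBigO_refl (fun n : ℕ => (n : ℝ) ^ (-(2 * a))) atTop)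
  simp only [one_mul] at h2
  refine h2.congr' ?_ EventuallyEq.rfl
  filter_upwards [eventually_gt_atTop 0] with n hn
  have hn' : (0 : ℝ) < n := by exact_mod_cast hn
  rw [div_pow, ← Real.rpow_natCast ((n : ℝ) ^ a), ← Real.rpow_mul hn'.le, div_mul_eq_mul_div,
    ← Real.rpow_add hn']
  have : a * ((2 : ℕ) : ℝ) + -(2 * a) = 0 := by push_cast; ring
  rw [this, Real.rpow_zero, one_div]

/-! ### Almost sure convergence by an L²-bounded martingale. -/

namespace IsElephantWalk

variable {Ω : Type*} [MeasurableSpace Ω] {P : Measure Ω} {p q : I}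
  {X Y : ℕ → Ω → ℝ} {κ : ℕ → Ω → ℕ} {ε : ℕ → Ω → ℝ}

/-- Allows passing to measurable versions of the steps, which the filtration requires. -/
lemma congr (hX : IsElephantWalk P p q X κ ε) (hXY : ∀ n, 1 ≤ n → X n =ᵐ[P] Y n) :
    IsElephantWalk P p q Y κ ε where
  first_step := hX.first_step.congr (hXY 1 le_rfl).symm
  time_law := hX.time_law
  sign_law := hX.sign_law
  indep_time_sign := hX.indep_time_sign
  indep_past n hn := by
    refine (hX.indep_past n hn).congr EventuallyEq.rfl ?_
    have hall : ∀ᵐ ω ∂P, ∀ i : Fin n, X (i + 1) ω = Y (i + 1) ω :=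
      ae_all_iff.2 fun i => hXY _ (by omega)
    filter_upwards [hall] with ω h
    exact funext h
  step n hn := by
    have hall : ∀ᵐ ω ∂P, ∀ k, 1 ≤ k → X k ω = Y k ω :=
      ae_all_iff.2 fun k => by
        by_cases hk : 1 ≤ k
        · filter_upwards [hXY k hk] with ω h _ using h
        · exact ae_of_all _ fun ω h => absurd h hk
    filter_upwards [hall, hX.step n hn, hX.ae_time_mem hn] with ω h1 h2 h3
    rw [← h1 _ (by omega), h2, h1 _ h3.1]

variable [IsProbabilityMeasure P]

lemma integrable_walkPosition_sq (hX : IsElephantWalk P p q X κ ε) (n : ℕ) :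
    Integrable (fun ω => walkPosition X n ω ^ 2) P := by
  refine .of_bound ((hX.aemeasurable_walkPosition n).pow_const 2).aestronglyMeasurable (n ^ 2) ?_
  filter_upwards [hX.ae_abs_walkPosition_le n] with ω h
  rw [norm_pow, Real.norm_eq_abs]
  gcongr

lemma integrable_step_mul_walkPosition (hX : IsElephantWalk P p q X κ ε) (n : ℕ) :
    Integrable (fun ω => X (n + 1) ω * walkPosition X n ω) P := by
  refine (hX.integrable_walkPosition n).bdd_mul (c := 1)
    (hX.aemeasurable_step (by omega)).aestronglyMeasurable ?_
  filter_upwards [hX.ae_abs_step (n := n + 1) (by omega)] with ω h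
  rcases h with h | h <;> simp [h]

lemma integral_walkPosition_succ_sq (hX : IsElephantWalk P p q X κ ε) {n : ℕ} (hn : 1 ≤ n) :
    ∫ ω, walkPosition X (n + 1) ω ^ 2 ∂P =
      (1 + 2 * ((2 * (p : ℝ) - 1) / n)) * ∫ ω, walkPosition X n ω ^ 2 ∂P + 1 := by
  have h1 := hX.integral_step_smul hn (g := fun x => ∑ i, x i)
    (Finset.stronglyMeasurable_fun_sum _ fun i _ => (measurable_pi_apply i).stronglyMeasurable)
    (by simpa only [← walkPosition_eq_sum_fin] using hX.integrable_walkPosition n)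
  simp only [← walkPosition_eq_sum_fin, smul_eq_mul] at h1
  have h2 : ∫ ω, walkPosition X (n + 1) ω ^ 2 ∂P = ∫ ω, (walkPosition X n ω ^ 2 +
      2 * (X (n + 1) ω * walkPosition X n ω) + 1) ∂P := by
    refine integral_congr_ae ?_
    filter_upwards [hX.ae_abs_step (n := n + 1) (by omega)] with ω h
    rw [walkPosition_succ]
    rcases h with h | h <;> rw [h] <;> ring
  rw [h2, integral_add, integral_add, integral_const_mul, h1]
  · simp only [← sq, integral_const, probReal_univ, smul_eq_mul]
    ring
  · exact hX.integrable_walkPosition_sq n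
  · exact (hX.integrable_step_mul_walkPosition n).const_mul 2
  · exact (hX.integrable_walkPosition_sq n).add
      ((hX.integrable_step_mul_walkPosition n).const_mul 2)
  · exact integrable_const _

lemma exists_integral_sq_le (hX : IsElephantWalk P p q X κ ε) {a : ℝ}
    (ha : a = 2 * (p : ℝ) - 1) (ha' : 1 / 2 < a) :
    ∃ C, ∀ n, ∫ ω, (walkPosition X (n + 1) ω / growthFactor a n) ^ 2 ∂P ≤ C := by
  have ha0 : 0 < a := by linarith
  have hsum := summable_inv_growthFactor_sq ha'
  have key : ∀ n, ∫ ω, (walkPosition X (n + 1) ω / growthFactor a n) ^ 2 ∂P ≤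
      ∑ k ∈ Finset.range (n + 1), (growthFactor a k ^ 2)⁻¹ := by
    intro n
    induction n with
    | zero =>
      have : (fun ω => (walkPosition X (0 + 1) ω / growthFactor a 0) ^ 2) =ᵐ[P] fun _ => 1 := by
        filter_upwards [hX.ae_abs_step (n := 1) le_rfl] with ω h
        simp only [zero_add, walkPosition_one, growthFactor, Finset.range_zero, Finset.prod_empty]
        rcases h with h | h <;> rw [h] <;> norm_num
      rw [integral_congr_ae this]
      simp [growthFactor]
    | succ n ih =>
      rw [Finset.sum_range_succ]
      refine le_trans ?_ (add_le_add_left ih _)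
      simp only [div_pow, div_eq_mul_inv _ (growthFactor a _ ^ 2), integral_mul_const]
      rw [hX.integral_walkPosition_succ_sq (n := n + 1) (by omega), ← ha, add_mul, one_mul]
      gcongr ?_ + _
      have h1 := growthFactor_pos ha0 n
      have h2 : 0 ≤ ∫ ω, walkPosition X (n + 1) ω ^ 2 ∂P := integral_nonneg fun _ => sq_nonneg _
      rw [growthFactor_succ, mul_pow, mul_inv, mul_comm (1 + 2 * _), mul_assoc]
      refine mul_le_mul_of_nonneg_left ?_ h2
      have h3 : (0 : ℝ) < 1 + a / (n + 1) := by positivity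
      rw [mul_left_comm]
      refine mul_le_of_le_one_right (by positivity) ?_
      rw [← div_eq_mul_inv, div_le_one (by positivity)]
      push_cast
      -- With `x = a / (n + 1)` this is `1 + 2 x ≤ (1 + x) ^ 2`, so each step adds at most the
      -- inverse square of the new growth factor.
      nlinarith [sq_nonneg (a / ((n : ℝ) + 1))]
  exact ⟨_, fun n => (key n).trans (hsum.sum_le_tsum _ fun _ _ => by positivity)⟩

/-- The filtration generated by the steps of the walk: at time `n`, the steps `X 1, …, X (n + 1)`
are known. -/
def stepFiltration (hm : ∀ n, Measurable (X n)) : Filtration ℕ ‹MeasurableSpace Ω› where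
  seq n := MeasurableSpace.comap (fun ω (i : Fin (n + 1)) => X (i + 1) ω) inferInstance
  mono' m n hmn := by
    have : (fun ω (i : Fin (m + 1)) => X (i + 1) ω) =
        (fun (x : Fin (n + 1) → ℝ) i => x (Fin.castLE (by omega) i)) ∘
          fun ω (i : Fin (n + 1)) => X (i + 1) ω := rfl
    simp only [this, ← MeasurableSpace.comap_comp]
    exact MeasurableSpace.comap_mono (Measurable.comap_le (by fun_prop))
  le' n := Measurable.comap_le (measurable_pi_lambda _ fun i => hm _)

lemma martingale (hX : IsElephantWalk P p q X κ ε) (hm : ∀ n, Measurable (X n)) {a : ℝ}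
    (ha : a = 2 * (p : ℝ) - 1) (ha0 : 0 < a) :
    Martingale (fun n ω => walkPosition X (n + 1) ω / growthFactor a n)
      (stepFiltration hm) P := by
  have hadp : StronglyAdapted (stepFiltration hm)
      (fun n ω => walkPosition X (n + 1) ω / growthFactor a n) := by
    intro n
    simp only [walkPosition_eq_sum_fin]
    have : Measurable[stepFiltration hm n] fun ω (i : Fin (n + 1)) => X (i + 1) ω :=
      comap_measurable _
    exact ((by fun_prop : Measurable fun x : Fin (n + 1) → ℝ =>
      (∑ i, x i) / growthFactor a n).comp this).stronglyMeasurable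
  have hint : ∀ n, Integrable (fun ω => walkPosition X (n + 1) ω / growthFactor a n) P :=
    fun n => (hX.integrable_walkPosition _).div_const _
  refine martingale_nat hadp hint fun n => ?_
  refine ae_eq_condExp_of_forall_setIntegral_eq ((stepFiltration hm).le n) (hint _)
    (fun _ _ _ => (hint n).integrableOn) ?_ (hadp n).aestronglyMeasurable
  rintro s ⟨T, hT, rfl⟩ -
  have hpast : Measurable fun ω (i : Fin (n + 1)) => X (i + 1) ω :=
    measurable_pi_lambda _ fun i => hm _
  have hs := hpast hT
  -- Testing the conditional mean against indicators of past events yields the conditional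
  -- expectation.
  have h1 := hX.integral_step_smul (n := n + 1) (by omega) (g := T.indicator fun _ => (1 : ℝ))
    (stronglyMeasurable_const.indicator hT)
    (.of_bound ((stronglyMeasurable_const.indicator hT).measurable.comp
      hpast).aestronglyMeasurable 1 (ae_of_all _ fun ω => by
        by_cases h : (fun i : Fin (n + 1) => X (i + 1) ω) ∈ T <;> simp [h]))
  have h2 : ∀ f : Ω → ℝ, ∫ ω, f ω • T.indicator (fun _ => (1 : ℝ))
      (fun i : Fin (n + 1) => X (i + 1) ω) ∂P =
      ∫ ω in (fun ω (i : Fin (n + 1)) => X (i + 1) ω) ⁻¹' T, f ω ∂P := by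
    intro f
    rw [← integral_indicator hs]
    refine integral_congr_ae (ae_of_all _ fun ω => ?_)
    by_cases h : (fun i : Fin (n + 1) => X (i + 1) ω) ∈ T <;> simp [h]
  rw [h2, h2, ← ha] at h1
  simp only [integral_div]
  simp only [walkPosition_succ X (n + 1)]
  have hstep : Integrable (X (n + 1 + 1)) P := by
    have := (hX.integrable_walkPosition (n + 2)).sub (hX.integrable_walkPosition (n + 1))
    refine this.congr (ae_of_all _ fun ω => ?_)
    simp [walkPosition_succ X (n + 1)]
  rw [integral_add (hX.integrable_walkPosition _).integrableOn hstep.integrableOn, h1,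
    growthFactor_succ]
  have := growthFactor_pos ha0 n
  have h3 : (0 : ℝ) < 1 + a / (n + 1) := by positivity
  push_cast
  simp only [smul_eq_mul]
  rw [← one_add_mul, mul_comm (growthFactor a n), mul_div_mul_left _ _ h3.ne']

lemma exists_isScalingLimit_of_measurable (hX : IsElephantWalk P p q X κ ε)
    (hm : ∀ n, Measurable (X n)) {a : ℝ} (ha : a = 2 * (p : ℝ) - 1) (ha' : 1 / 2 < a) :
    ∃ L : Ω → ℝ, Measurable L ∧ IsScalingLimit P X a L := by
  have ha0 : 0 < a := by linarith
  obtain ⟨C, hC⟩ := hX.exists_integral_sq_le ha ha'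
  have hM := hX.martingale hm ha ha0
  have hbdd : ∀ n, eLpNorm (fun ω => walkPosition X (n + 1) ω / growthFactor a n) 1 P ≤
      (Real.toNNReal (1 + C) : ENNReal) := by
    intro n
    have hi := hM.integrable n
    have hsq : Integrable (fun ω => (walkPosition X (n + 1) ω / growthFactor a n) ^ 2) P := by
      simpa only [div_pow] using (hX.integrable_walkPosition_sq (n + 1)).div_const _
    rw [eLpNorm_one_eq_lintegral_enorm, ← ofReal_integral_norm_eq_lintegral_enorm hi]
    refine ENNReal.ofReal_le_ofReal ?_
    calc ∫ ω, ‖walkPosition X (n + 1) ω / growthFactor a n‖ ∂P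
        ≤ ∫ ω, (1 + (walkPosition X (n + 1) ω / growthFactor a n) ^ 2) ∂P := by
          refine integral_mono hi.norm ((integrable_const 1).add hsq) fun ω => ?_
          simp only [Real.norm_eq_abs]
          -- The bound `|x| ≤ 1 + x ^ 2` passes from L² to the L¹ bound required by martingale
          -- convergence.
          set x := walkPosition X (n + 1) ω / growthFactor a n
          nlinarith [sq_nonneg (|x| - 1), sq_abs x, abs_nonneg x]
      _ ≤ 1 + C := by
          rw [integral_add (integrable_const 1) hsq]
          simpa using hC n
  obtain ⟨f, hf, hconv⟩ := measurable_limit_of_tendsto_metrizable_ae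
    (fun n => (hM.integrable n).aestronglyMeasurable.aemeasurable)
    (hM.submartingale.exists_ae_tendsto_of_bdd hbdd)
  refine ⟨fun ω => f ω * (a * Real.Gamma a)⁻¹, hf.mul_const _, ?_⟩
  filter_upwards [hconv] with ω h
  rw [← tendsto_add_atTop_iff_nat 1]
  refine (h.mul (tendsto_growthFactor_div_rpow ha0)).congr fun n => ?_
  have := growthFactor_pos ha0 n
  field_simp

/-- The rescaled superdiffusive elephant random walk converges almost surely. -/
theorem exists_isScalingLimit (hX : IsElephantWalk P p q X κ ε) {a : ℝ}
    (ha : a = 2 * (p : ℝ) - 1) (ha' : 1 / 2 < a) :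
    ∃ L : Ω → ℝ, Measurable L ∧ IsScalingLimit P X a L := by
  classical
  let Y : ℕ → Ω → ℝ := fun n => if h : 1 ≤ n then (hX.aemeasurable_step h).mk (X n) else 0
  have hXY : ∀ n, 1 ≤ n → X n =ᵐ[P] Y n := fun n hn => by
    simpa only [Y, dif_pos hn] using (hX.aemeasurable_step hn).ae_eq_mk
  have hY : ∀ n, Measurable (Y n) := fun n => by
    by_cases hn : 1 ≤ n
    · simpa only [Y, dif_pos hn] using (hX.aemeasurable_step hn).measurable_mk
    · simpa only [Y, dif_neg hn] using measurable_zero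
  obtain ⟨L, hL, hlim⟩ := (hX.congr hXY).exists_isScalingLimit_of_measurable hY ha ha'
  refine ⟨L, hL, ?_⟩
  have hall : ∀ᵐ ω ∂P, ∀ n, walkPosition X n ω = walkPosition Y n ω := by
    have : ∀ᵐ ω ∂P, ∀ i : ℕ, X (i + 1) ω = Y (i + 1) ω :=
      ae_all_iff.2 fun i => hXY _ (by omega)
    filter_upwards [this] with ω h n
    simp only [walkPosition_eq_sum_fin, h]
  filter_upwards [hlim, hall] with ω h1 h2
  simpa only [h2] using h1

end IsElephantWalk

/-! ### The discrete fixed-point identity for characteristic functions. -/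

/-- The convolution identity satisfied by the solutions of the recursion
`n f (n + 1) = n cos f n + a sin f' n`. -/
lemma convolution_identity_of_recursion {a p : ℝ} (ha : a = 2 * p - 1) {f f' : ℕ → ℝ → ℂ}
    (hderiv : ∀ n t, HasDerivAt (f (n + 1)) (f' (n + 1) t) t)
    (hone : ∀ t : ℝ, f 1 t = Complex.exp (t * Complex.I))
    (hrec : ∀ n (t : ℝ), ((n + 1 : ℕ) : ℂ) * f (n + 2) t =
      (n + 1 : ℕ) * (Real.cos t * f (n + 1) t) + a * (Real.sin t * f' (n + 1) t))
    (m : ℕ) (t : ℝ) :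
    ∑ i ∈ Finset.range m, f (i + 1) t * (p * f (m - i) t + (1 - p) * f (m - i) (-t)) =
      m * f (m + 1) t := by
  set h : ℕ → ℝ → ℂ := fun j t => p * f j t + (1 - p) * f j (-t) with hh
  set h' : ℕ → ℝ → ℂ := fun j t => p * f' j t + (1 - p) * (-f' j (-t)) with hh'
  have hderiv' : ∀ n t, HasDerivAt (h (n + 1)) (h' (n + 1) t) t := fun n t => by
    have h1 := (hderiv n (-t)).scomp t (hasDerivAt_neg t)
    rw [neg_one_smul] at h1
    exact ((hderiv n t).const_mul _).add (h1.const_mul _)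
  -- Under `t ↦ -t` both the sine and the derivative change sign, so `h` obeys the same recursion as
  -- `f`.
  have hrec' : ∀ n (t : ℝ), (a : ℂ) * (Real.sin t * h' (n + 1) t) =
      (n + 1 : ℕ) * (h (n + 2) t - Real.cos t * h (n + 1) t) := fun n t => by
    have h1 := hrec n t
    have h2 := hrec n (-t)
    simp only [Real.cos_neg, Real.sin_neg, Complex.ofReal_neg] at h2
    simp only [hh, hh']
    linear_combination -(p : ℂ) * h1 - (1 - (p : ℂ)) * h2
  rcases m with _ | m
  · simp
  change ∑ i ∈ Finset.range (m + 1), f (i + 1) t * h (m + 1 - i) t = (m + 1 : ℕ) * f (m + 2) t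
  induction m generalizing t with
  | zero =>
    have h1 : f' 1 t = Complex.I * Complex.exp (t * Complex.I) := by
      have h2 : HasDerivAt (fun t : ℝ => Complex.exp (t * Complex.I))
          (Complex.exp (t * Complex.I) * (1 * Complex.I)) t :=
        ((Complex.ofRealCLM.hasDerivAt (x := t)).mul_const Complex.I).cexp
      have h3 := (hderiv 0 t).unique (h2.congr_of_eventuallyEq (Eventually.of_forall hone))
      rw [zero_add] at h3
      rw [h3]
      ring
    -- The base case is `p e^{it} + (1 - p) e^{-it} = cos t + i a sin t`, which uses `a = 2p - 1`.
    rw [hrec 0 t]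
    simp only [zero_add, Finset.range_one, Finset.sum_singleton, Nat.sub_zero, h1, hh, hone, ha]
    rw [Complex.ofReal_neg, Complex.exp_mul_I (-(t : ℂ)), Complex.exp_mul_I, Complex.cos_neg,
      Complex.sin_neg]
    push_cast
    ring
  | succ m ih =>
    -- The induction hypothesis holds for all `t`, hence may be differentiated.
    have hd : ((m + 1 : ℕ) : ℂ) * f' (m + 2) t = ∑ i ∈ Finset.range (m + 1),
        (f' (i + 1) t * h (m + 1 - i) t + f (i + 1) t * h' (m + 1 - i) t) := by
      have h1 := (hderiv (m + 1) t).const_mul ((m + 1 : ℕ) : ℂ)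
      refine h1.unique (HasDerivAt.congr_of_eventuallyEq (f := fun t =>
        ∑ i ∈ Finset.range (m + 1), f (i + 1) t * h (m + 1 - i) t) ?_
          (Eventually.of_forall fun t => (ih t).symm))
      refine HasDerivAt.fun_sum fun i hi => ?_
      have hi' : m + 1 - i = m - i + 1 := by have := Finset.mem_range.1 hi; omega
      rw [hi']
      exact (hderiv i t).mul (hderiv' (m - i) t)
    -- Multiplying by `a sin t` lets the recursions eliminate both derivatives. The cosine weights
    -- `i + 1` and `m + 1 - i` add up to `m + 2`.
    have hterm : ∀ i ∈ Finset.range (m + 1),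
        (a : ℂ) * Real.sin t * (f' (i + 1) t * h (m + 1 - i) t + f (i + 1) t * h' (m + 1 - i) t) =
        ((i + 1 : ℕ) : ℂ) * (f (i + 1 + 1) t * h (m + 1 - i) t) +
        ((m + 1 : ℕ) - (i : ℂ)) * (f (i + 1) t * h (m + 2 - i) t) -
        (m + 2 : ℕ) * Real.cos t * (f (i + 1) t * h (m + 1 - i) t) := by
      intro i hi
      have hle : i ≤ m := by have := Finset.mem_range.1 hi; omega
      obtain ⟨d, rfl⟩ := Nat.exists_eq_add_of_le hle
      have e1 : i + d + 1 - i = d + 1 := by omega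
      have e2 : i + d + 2 - i = d + 2 := by omega
      have h1 := hrec i t
      have h2 := hrec' d t
      rw [e1, e2]
      push_cast at h1 h2 ⊢
      linear_combination (-h (d + 1) t) * h1 + f (i + 1) t * h2
    -- After this shift and the added zero term in `h2`, the weights `i` and `m + 1 - i` combine to
    -- the constant `m + 1`.
    have h1 : ∑ i ∈ Finset.range (m + 1),
        ((i + 1 : ℕ) : ℂ) * (f (i + 1 + 1) t * h (m + 1 - i) t) =
        ∑ i ∈ Finset.range (m + 2), (i : ℂ) * (f (i + 1) t * h (m + 2 - i) t) := by
      rw [Finset.sum_range_succ' _ (m + 1)]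
      simp only [Nat.cast_zero, zero_mul, add_zero]
      refine Finset.sum_congr rfl fun i _ => ?_
      rw [show m + 2 - (i + 1) = m + 1 - i by omega]
    have h2 : ∑ i ∈ Finset.range (m + 1),
        ((m + 1 : ℕ) - (i : ℂ)) * (f (i + 1) t * h (m + 2 - i) t) =
        ∑ i ∈ Finset.range (m + 2),
          ((m + 1 : ℕ) - (i : ℂ)) * (f (i + 1) t * h (m + 2 - i) t) := by
      rw [Finset.sum_range_succ _ (m + 1), sub_self, zero_mul, add_zero]
    have hsum : (a : ℂ) * Real.sin t * (((m + 1 : ℕ) : ℂ) * f' (m + 2) t) =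
        (m + 1 : ℕ) * ∑ i ∈ Finset.range (m + 2), f (i + 1) t * h (m + 2 - i) t -
        (m + 2 : ℕ) * Real.cos t * ((m + 1 : ℕ) * f (m + 2) t) := by
      rw [hd, Finset.mul_sum, Finset.sum_congr rfl hterm, Finset.sum_sub_distrib,
        Finset.sum_add_distrib, h1, h2, ← Finset.sum_add_distrib, ← Finset.mul_sum, ih t,
        Finset.mul_sum]
      congr 1
      refine Finset.sum_congr rfl fun i _ => ?_
      ring
    have hne : ((m + 1 : ℕ) : ℂ) ≠ 0 := by exact_mod_cast Nat.succ_ne_zero m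
    refine mul_left_cancel₀ hne ?_
    have h3 := hrec (m + 1) t
    linear_combination -hsum - ((m + 1 : ℕ) : ℂ) * h3

/-- The characteristic function of the position of a walk at time `n`. -/
noncomputable def walkCharFun {Ω : Type*} [MeasurableSpace Ω] (P : Measure Ω) (X : ℕ → Ω → ℝ)
    (n : ℕ) (t : ℝ) : ℂ :=
  ∫ ω, Complex.exp (t * walkPosition X n ω * Complex.I) ∂P

lemma norm_exp_real_mul_real_mul_I (s x : ℝ) :
    ‖Complex.exp (s * x * Complex.I)‖ = 1 := by
  rw [← Complex.ofReal_mul, Complex.norm_exp_ofReal_mul_I]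

namespace IsElephantWalk

variable {Ω : Type*} [MeasurableSpace Ω] {P : Measure Ω} {p q : I}
  {X : ℕ → Ω → ℝ} {κ : ℕ → Ω → ℕ} {ε : ℕ → Ω → ℝ}

lemma aestronglyMeasurable_exp (hX : IsElephantWalk P p q X κ ε) (n : ℕ) (t : ℝ) :
    AEStronglyMeasurable (fun ω => Complex.exp (t * walkPosition X n ω * Complex.I)) P :=
  ((by fun_prop : Measurable fun x : ℝ => Complex.exp (t * x * Complex.I)).comp_aemeasurable
    (hX.aemeasurable_walkPosition n)).aestronglyMeasurable

variable [IsProbabilityMeasure P]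

lemma integrable_exp (hX : IsElephantWalk P p q X κ ε) (n : ℕ) (t : ℝ) :
    Integrable (fun ω => Complex.exp (t * walkPosition X n ω * Complex.I)) P :=
  .of_bound (hX.aestronglyMeasurable_exp n t) 1
    (ae_of_all _ fun _ => (norm_exp_real_mul_real_mul_I _ _).le)

lemma integrable_walkPosition_smul_exp (hX : IsElephantWalk P p q X κ ε) (n : ℕ) (t : ℝ) :
    Integrable (fun ω => walkPosition X n ω •
      Complex.exp (t * walkPosition X n ω * Complex.I)) P :=
  (hX.integrable_walkPosition n).smul_bdd 1 (hX.aestronglyMeasurable_exp n t)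
    (ae_of_all _ fun _ => (norm_exp_real_mul_real_mul_I _ _).le)

lemma hasDerivAt_walkCharFun (hX : IsElephantWalk P p q X κ ε) (n : ℕ) (t : ℝ) :
    HasDerivAt (walkCharFun P X n) (∫ ω, Complex.I * (walkPosition X n ω •
      Complex.exp (t * walkPosition X n ω * Complex.I)) ∂P) t := by
  refine (hasDerivAt_integral_of_dominated_loc_of_deriv_le (bound := fun _ => (n : ℝ))
    (F' := fun s ω => Complex.I * (walkPosition X n ω •
      Complex.exp (s * walkPosition X n ω * Complex.I)))
    univ_mem (Eventually.of_forall fun s => hX.aestronglyMeasurable_exp n s)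
    (hX.integrable_exp n t)
    ((hX.integrable_walkPosition_smul_exp n t).const_mul Complex.I).aestronglyMeasurable
    ?_ (integrable_const _) (ae_of_all _ fun ω s _ => ?_)).2
  · filter_upwards [hX.ae_abs_walkPosition_le n] with ω h s _
    rw [norm_mul, norm_smul, norm_exp_real_mul_real_mul_I]
    simpa using h
  · have h1 : HasDerivAt (fun s : ℝ => (s : ℂ) * walkPosition X n ω * Complex.I)
        (1 * walkPosition X n ω * Complex.I) s :=
      ((Complex.ofRealCLM.hasDerivAt (x := s)).mul_const _).mul_const _
    refine h1.cexp.congr_deriv ?_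
    rw [Complex.real_smul]
    ring

/-- For `x = ±1`, `e^{itx} = cos t + i x sin t` is affine in `x`, so the conditional mean of the
step suffices. The remaining integral is the derivative of `walkCharFun P X n`. -/
lemma walkCharFun_succ (hX : IsElephantWalk P p q X κ ε) {n : ℕ} (hn : 1 ≤ n) (t : ℝ) :
    walkCharFun P X (n + 1) t = Real.cos t * walkCharFun P X n t +
      ((2 * (p : ℝ) - 1) / n : ℝ) * (Real.sin t * ∫ ω, Complex.I * (walkPosition X n ω •
        Complex.exp (t * walkPosition X n ω * Complex.I)) ∂P) := by
  have hg : StronglyMeasurable fun x : Fin n → ℝ =>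
      Complex.exp (t * ((∑ i, x i : ℝ) : ℂ) * Complex.I) :=
    (by fun_prop : Measurable _).stronglyMeasurable
  have h1 := hX.integral_step_smul hn hg
    (by simpa only [← walkPosition_eq_sum_fin] using hX.integrable_exp n t)
  simp only [← walkPosition_eq_sum_fin] at h1
  have h2 : walkCharFun P X (n + 1) t = ∫ ω,
      (Real.cos t * Complex.exp (t * walkPosition X n ω * Complex.I) +
        Real.sin t * Complex.I *
          (X (n + 1) ω • Complex.exp (t * walkPosition X n ω * Complex.I))) ∂P := by
    refine integral_congr_ae ?_
    filter_upwards [hX.ae_abs_step (n := n + 1) (by omega)] with ω h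
    rw [walkPosition_succ, Complex.ofReal_add, mul_add, add_mul, Complex.exp_add, Complex.real_smul]
    have h3 : Complex.exp (t * (X (n + 1) ω : ℂ) * Complex.I) =
        Real.cos t + Real.sin t * Complex.I * X (n + 1) ω := by
      rw [Complex.exp_mul_I]
      rcases h with h | h <;> rw [h] <;> simp
    rw [h3]
    ring
  have hstep : Integrable (fun ω => X (n + 1) ω •
      Complex.exp (t * walkPosition X n ω * Complex.I)) P := by
    refine (hX.integrable_exp n t).bdd_smul 1
      (hX.aemeasurable_step (by omega)).aestronglyMeasurable ?_
    filter_upwards [hX.ae_abs_step (n := n + 1) (by omega)] with ω h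
    rcases h with h | h <;> simp [h]
  rw [h2, integral_add ((hX.integrable_exp n t).const_mul _) (hstep.const_mul _),
    integral_const_mul, integral_const_mul, h1, integral_const_mul, Complex.real_smul, walkCharFun]
  ring

/-- The law of the position at time `m + 1` is a mixture over `0 ≤ i < m` of the laws of
`S (i + 1) ± S' (m - i)`, where `S'` is an independent copy of `S`. -/
lemma walkCharFun_convolution (hX : IsElephantWalk P p 1 X κ ε) (m : ℕ) (t : ℝ) :
    ∑ i ∈ Finset.range m, walkCharFun P X (i + 1) t *
      ((p : ℝ) * walkCharFun P X (m - i) t + (1 - (p : ℝ)) * walkCharFun P X (m - i) (-t)) =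
      m * walkCharFun P X (m + 1) t := by
  refine convolution_identity_of_recursion (f' := fun n t => ∫ ω, Complex.I *
      (walkPosition X n ω • Complex.exp (t * walkPosition X n ω * Complex.I)) ∂P) rfl
    (fun n t => hX.hasDerivAt_walkCharFun (n + 1) t) (fun t => ?_) (fun n t => ?_) m t
  · have h := hX.first_step
    rw [bernoulliMeasure_one] at h
    have h1 : (fun ω => Complex.exp (t * walkPosition X 1 ω * Complex.I)) =ᵐ[P]
        fun _ => Complex.exp (t * Complex.I) := by
      filter_upwards [h.ae_eq_of_dirac] with ω h
      simp [walkPosition_one, h]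
    rw [walkCharFun, integral_congr_ae h1]
    simp
  · rw [hX.walkCharFun_succ (n := n + 1) (by omega) t]
    have hne : ((n + 1 : ℕ) : ℂ) ≠ 0 := by exact_mod_cast Nat.succ_ne_zero n
    rw [Complex.ofReal_div, Complex.ofReal_natCast, mul_add, div_mul_eq_mul_div,
      mul_div_cancel₀ _ hne]

end IsElephantWalk

/-! ### Passage to the limit in the discrete identity. -/

lemma integral_floor {E : Type*} [NormedAddCommGroup E] [NormedSpace ℝ E] [CompleteSpace E]
    (F : ℕ → E) (m : ℕ) :
    ∫ x in (0 : ℝ)..m, F ⌊x⌋₊ = ∑ i ∈ Finset.range m, F i := by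
  have hcongr : ∀ i : ℕ, Set.EqOn (fun _ => F i) (fun x : ℝ => F ⌊x⌋₊)
      (Set.Ioo (i : ℝ) ((i + 1 : ℕ) : ℝ)) := fun i x hx => by
    have : ⌊x⌋₊ = i := by
      rw [Nat.floor_eq_iff ((Nat.cast_nonneg i).trans hx.1.le)]
      exact ⟨hx.1.le, by simpa using hx.2⟩
    simp only [this]
  have hae : ∀ i : ℕ, (fun _ => F i) =ᵐ[volume.restrict (Set.uIoc (i : ℝ) ((i + 1 : ℕ) : ℝ))]
      (fun x : ℝ => F ⌊x⌋₊) := fun i => by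
    rw [Set.uIoc_of_le (by simp), Filter.EventuallyEq, ← restrict_Ioo_eq_restrict_Ioc]
    exact (ae_restrict_mem measurableSet_Ioo).mono fun x hx => hcongr i hx
  have hint : ∀ i : ℕ, IntervalIntegrable (fun x : ℝ => F ⌊x⌋₊) volume i ((i + 1 : ℕ) : ℝ) :=
    fun i => (intervalIntegrable_const (c := F i)).congr_ae (hae i)
  have hsum := intervalIntegral.sum_integral_adjacent_intervals (n := m)
    (a := fun i : ℕ => (i : ℝ)) fun i _ => hint i
  rw [Nat.cast_zero] at hsum
  rw [← hsum]
  refine Finset.sum_congr rfl fun i _ => ?_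
  rw [← intervalIntegral.integral_congr_ae_restrict (hae i)]
  simp

/-- Convergence of averages to an integral, by dominated convergence. -/
lemma tendsto_average {F : ℕ → ℕ → ℂ} {G : ℝ → ℂ} {C : ℝ} (hF : ∀ m i, ‖F m i‖ ≤ C)
    (hlim : ∀ v ∈ Set.Ioo (0 : ℝ) 1,
      Tendsto (fun m : ℕ => F m ⌊v * (m : ℝ)⌋₊) atTop (𝓝 (G v))) :
    Tendsto (fun m : ℕ => (m : ℂ)⁻¹ * ∑ i ∈ Finset.range m, F m i) atTop
      (𝓝 (∫ v in (0 : ℝ)..1, G v)) := by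
  have h1 : Tendsto (fun m : ℕ => ∫ v in (0 : ℝ)..1, F m ⌊v * (m : ℝ)⌋₊) atTop
      (𝓝 (∫ v in (0 : ℝ)..1, G v)) := by
    refine intervalIntegral.tendsto_integral_filter_of_dominated_convergence (fun _ => C)
      (Eventually.of_forall fun m => ?_) (Eventually.of_forall fun m => ae_of_all _ fun v _ =>
        hF m _) intervalIntegrable_const ?_
    · have : Measurable (F m) := measurable_from_nat
      exact (this.comp (Nat.measurable_floor.comp
        (measurable_id.mul_const (m : ℝ)))).aestronglyMeasurable
    · have h0 : ∀ᵐ v : ℝ, v ≠ 1 := by simp [ae_iff]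
      filter_upwards [h0] with v hv hmem
      rw [Set.uIoc_of_le zero_le_one] at hmem
      exact hlim v ⟨hmem.1, lt_of_le_of_ne hmem.2 hv⟩
  refine h1.congr' ?_
  filter_upwards [eventually_gt_atTop 0] with m hm
  have hm' : (m : ℝ) ≠ 0 := by exact_mod_cast hm.ne'
  rw [intervalIntegral.integral_comp_mul_right (fun x => F m ⌊x⌋₊) hm', zero_mul, one_mul,
    integral_floor, Complex.real_smul]
  simp

lemma norm_walkCharFun_le {Ω : Type*} [MeasurableSpace Ω] (P : Measure Ω) [IsProbabilityMeasure P]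
    (X : ℕ → Ω → ℝ) (n : ℕ) (t : ℝ) : ‖walkCharFun P X n t‖ ≤ 1 := by
  refine (norm_integral_le_integral_norm _).trans ?_
  simp [norm_exp_real_mul_real_mul_I]

namespace IsElephantWalk

variable {Ω : Type*} [MeasurableSpace Ω] {P : Measure Ω} {p q : I}
  {X : ℕ → Ω → ℝ} {κ : ℕ → Ω → ℕ} {ε : ℕ → Ω → ℝ} {a : ℝ} {L : Ω → ℝ}

lemma aemeasurable_scalingLimit (hX : IsElephantWalk P p q X κ ε) (hL : IsScalingLimit P X a L) :
    AEMeasurable L P :=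
  aemeasurable_of_tendsto_metrizable_ae atTop
    (fun n => (hX.aemeasurable_walkPosition n).div_const _) hL

variable [IsProbabilityMeasure P]

/-- Write `s m * S (k m)` as `s m * (k m) ^ a` times the rescaled position and use dominated
convergence. -/
lemma tendsto_walkCharFun (hX : IsElephantWalk P p q X κ ε) (hL : IsScalingLimit P X a L)
    {k : ℕ → ℕ} (hk : Tendsto k atTop atTop) {s : ℕ → ℝ} {s₀ : ℝ}
    (hs : Tendsto (fun m => s m * (k m : ℝ) ^ a) atTop (𝓝 s₀)) :
    Tendsto (fun m => walkCharFun P X (k m) (s m)) atTop (𝓝 (charFun (P.map L) s₀)) := by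
  have hLm := hX.aemeasurable_scalingLimit hL
  rw [charFun_apply_real, integral_map hLm (by fun_prop)]
  refine tendsto_integral_of_dominated_convergence (fun _ => 1)
    (fun m => hX.aestronglyMeasurable_exp _ _) (integrable_const _)
    (fun m => ae_of_all _ fun _ => (norm_exp_real_mul_real_mul_I _ _).le) ?_
  filter_upwards [hL] with ω h
  have h1 : Tendsto (fun m => s m * walkPosition X (k m) ω) atTop (𝓝 (s₀ * L ω)) := by
    refine (hs.mul (h.comp hk)).congr' ?_
    filter_upwards [hk.eventually_gt_atTop 0] with m hm
    have : (0 : ℝ) < k m := by exact_mod_cast hm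
    have : (k m : ℝ) ^ a ≠ 0 := by positivity
    simp only [Function.comp]
    field_simp
  have h2 := ((by fun_prop : Continuous fun x : ℝ => Complex.exp (x * Complex.I)).tendsto _).comp h1
  simpa [Function.comp_def] using h2

/-- With `i = ⌊v m⌋`, the time fractions `(i + 1) / (m + 1)` and `(m - i) / (m + 1)` tend to `v` and
`1 - v`. -/
lemma charFun_scalingLimit (hX : IsElephantWalk P p 1 X κ ε) (ha : 0 < a)
    (hL : IsScalingLimit P X a L) (t : ℝ) :
    charFun (P.map L) t = ∫ v in (0 : ℝ)..1, charFun (P.map L) (v ^ a * t) *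
      ((p : ℝ) * charFun (P.map L) ((1 - v) ^ a * t) +
        (1 - (p : ℝ)) * charFun (P.map L) (-((1 - v) ^ a * t))) := by
  set τ : ℕ → ℝ := fun m => t / ((m + 1 : ℕ) : ℝ) ^ a with hτ
  have hscale : ∀ {k : ℕ → ℕ} {v : ℝ}, Tendsto (fun m => (k m : ℝ) / (m + 1 : ℕ)) atTop (𝓝 v) →
      Tendsto (fun m => τ m * (k m : ℝ) ^ a) atTop (𝓝 (v ^ a * t)) := by
    intro k v hk
    refine ((hk.rpow_const (Or.inr ha.le)).mul_const t).congr fun m => ?_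
    rw [Real.div_rpow (by positivity) (by positivity)]
    simp only [hτ]
    ring
  have hself : Tendsto (fun m => walkCharFun P X (m + 1) (τ m)) atTop
      (𝓝 (charFun (P.map L) t)) := by
    have h1 : Tendsto (fun m : ℕ => ((m + 1 : ℕ) : ℝ) / (m + 1 : ℕ)) atTop (𝓝 1) :=
      tendsto_const_nhds.congr fun m => (div_self (by positivity)).symm
    have h2 := hscale (k := fun m => m + 1) h1
    rw [Real.one_rpow, one_mul] at h2
    exact hX.tendsto_walkCharFun hL (tendsto_add_atTop_nat 1) h2
  have hp : ‖((p : ℝ) : ℂ)‖ + ‖1 - ((p : ℝ) : ℂ)‖ = 1 := by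
    rw [← Complex.ofReal_one, ← Complex.ofReal_sub, Complex.norm_real, Complex.norm_real,
      Real.norm_of_nonneg p.2.1, Real.norm_of_nonneg (sub_nonneg.2 p.2.2)]
    ring
  have hav := tendsto_average (C := 1) (F := fun m i => walkCharFun P X (i + 1) (τ m) *
      ((p : ℝ) * walkCharFun P X (m - i) (τ m) +
        (1 - (p : ℝ)) * walkCharFun P X (m - i) (-τ m)))
    (G := fun v => charFun (P.map L) (v ^ a * t) *
      ((p : ℝ) * charFun (P.map L) ((1 - v) ^ a * t) +
        (1 - (p : ℝ)) * charFun (P.map L) (-((1 - v) ^ a * t)))) ?_ ?_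
  · refine tendsto_nhds_unique hself (hav.congr' ?_)
    filter_upwards [eventually_gt_atTop 0] with m hm
    have hm' : (m : ℂ) ≠ 0 := by exact_mod_cast hm.ne'
    rw [hX.walkCharFun_convolution, inv_mul_cancel_left₀ hm']
  · intro m i
    rw [norm_mul]
    refine mul_le_one₀ (norm_walkCharFun_le _ _ _ _) (norm_nonneg _) ?_
    refine (norm_add_le _ _).trans (le_of_le_of_eq ?_ hp)
    rw [norm_mul, norm_mul]
    exact add_le_add (mul_le_of_le_one_right (norm_nonneg _) (norm_walkCharFun_le _ _ _ _))
      (mul_le_of_le_one_right (norm_nonneg _) (norm_walkCharFun_le _ _ _ _))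
  · intro v hv
    have hfl : Tendsto (fun m : ℕ => (⌊v * (m : ℝ)⌋₊ : ℝ) / m) atTop (𝓝 v) :=
      (tendsto_nat_floor_mul_div_atTop hv.1.le).comp tendsto_natCast_atTop_atTop
    have hratio : Tendsto (fun m : ℕ => (m : ℝ) / (m + 1)) atTop (𝓝 1) :=
      tendsto_natCast_div_add_atTop (1 : ℝ)
    have hinv : Tendsto (fun m : ℕ => 1 / ((m : ℝ) + 1)) atTop (𝓝 0) :=
      tendsto_one_div_add_atTop_nhds_zero_nat
    have hle : ∀ m : ℕ, ⌊v * (m : ℝ)⌋₊ ≤ m := fun m =>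
      Nat.floor_le_of_le (mul_le_of_le_one_left (Nat.cast_nonneg m) hv.2.le)
    have hk : Tendsto (fun m : ℕ => ((⌊v * (m : ℝ)⌋₊ + 1 : ℕ) : ℝ) / (m + 1 : ℕ)) atTop (𝓝 v) := by
      have h1 := (hfl.mul hratio).add hinv
      rw [mul_one, add_zero] at h1
      refine h1.congr' ?_
      filter_upwards [eventually_gt_atTop 0] with m hm
      have hm' : (m : ℝ) ≠ 0 := by exact_mod_cast hm.ne'
      push_cast
      field_simp
    have hk' : Tendsto (fun m : ℕ => ((m - ⌊v * (m : ℝ)⌋₊ : ℕ) : ℝ) / (m + 1 : ℕ)) atTop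
        (𝓝 (1 - v)) := by
      refine (hk.const_sub 1).congr fun m => ?_
      rw [Nat.cast_sub (hle m)]
      have : (m : ℝ) + 1 ≠ 0 := by positivity
      push_cast
      field_simp
      ring
    -- Both times must tend to infinity, hence the restriction to `0 < v < 1`.
    have htop : ∀ {k : ℕ → ℕ} {w : ℝ}, 0 < w →
        Tendsto (fun m => (k m : ℝ) / (m + 1 : ℕ)) atTop (𝓝 w) → Tendsto k atTop atTop := by
      intro k w hw h
      have h1 : Tendsto (fun m : ℕ => ((m + 1 : ℕ) : ℝ)) atTop atTop :=
        tendsto_natCast_atTop_atTop.comp (tendsto_add_atTop_nat 1)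
      refine tendsto_natCast_atTop_iff.1 ((h.pos_mul_atTop hw h1).congr fun m => ?_)
      exact div_mul_cancel₀ _ (by positivity)
    have hw : 0 < 1 - v := sub_pos.2 hv.2
    have hneg : Tendsto (fun m => -τ m * ((m - ⌊v * (m : ℝ)⌋₊ : ℕ) : ℝ) ^ a) atTop
        (𝓝 (-((1 - v) ^ a * t))) := by
      simpa only [neg_mul] using (hscale hk').neg
    exact (hX.tendsto_walkCharFun hL (htop hv.1 hk) (hscale hk)).mul
      (((hX.tendsto_walkCharFun hL (htop hw hk') (hscale hk')).const_mul _).add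
        ((hX.tendsto_walkCharFun hL (htop hw hk') hneg).const_mul _))

end IsElephantWalk

/-! ### The right-hand side of the fixed-point equation, and the conclusion. -/

/-- The characteristic function of `V ^ a * L + (2 ξ - 1) * (1 - V) ^ a * L'` for independent
`V` uniform, `ξ` Bernoulli, and `L`, `L'` with the same law. -/
lemma charFun_uniform_mixture {Ω : Type*} [MeasurableSpace Ω] {P : Measure Ω}
    [IsProbabilityMeasure P] {p : I} {a : ℝ} {V ξ L L' : Ω → ℝ} {ν : Measure ℝ}
    (hV : pdf.IsUniform V (Set.Icc 0 1) P) (hξ : HasLaw ξ (bernoulliMeasure (1 : ℝ) 0 p) P)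
    (hL : HasLaw L ν P) (hL' : HasLaw L' ν P) (hind : iIndepFun ![V, ξ, L, L'] P) (t : ℝ) :
    charFun (P.map fun ω => V ω ^ a * L ω + (2 * ξ ω - 1) * (1 - V ω) ^ a * L' ω) t =
      ∫ v in (0 : ℝ)..1, charFun ν (v ^ a * t) *
        ((p : ℝ) * charFun ν ((1 - v) ^ a * t) + (1 - (p : ℝ)) * charFun ν (-((1 - v) ^ a * t))) := by
  have hVm : AEMeasurable V P := hV.aemeasurable (by simp) (by simp)
  have hVlaw : P.map V = volume.restrict (Set.Ioc 0 1) := by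
    have h : P.map V = ProbabilityTheory.cond volume (Set.Icc 0 1) := hV
    rw [h, ProbabilityTheory.cond, restrict_Ioc_eq_restrict_Icc]
    simp
  have := hL.isProbabilityMeasure_iff.1 inferInstance
  have hmeas : ∀ i, AEMeasurable (![V, ξ, L, L'] i) P := by
    intro i
    fin_cases i
    exacts [hVm, hξ.aemeasurable, hL.aemeasurable, hL'.aemeasurable]
  have hVξ : IndepFun V ξ P := hind.indepFun (i := 0) (j := 1) (by decide)
  have hLL : IndepFun L L' P := hind.indepFun (i := 2) (j := 3) (by decide)
  have hpair : IndepFun (fun ω => (V ω, ξ ω)) (fun ω => (L ω, L' ω)) P :=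
    hind.indepFun_prodMk_prodMk₀ hmeas 0 1 2 3 (by decide) (by decide) (by decide) (by decide)
  have hZm : AEMeasurable (fun ω => ((V ω, ξ ω), (L ω, L' ω))) P :=
    (hVm.prodMk hξ.aemeasurable).prodMk (hL.aemeasurable.prodMk hL'.aemeasurable)
  have hmap : P.map (fun ω => ((V ω, ξ ω), (L ω, L' ω))) =
      ((P.map V).prod (bernoulliMeasure (1 : ℝ) 0 p)).prod (ν.prod ν) := by
    rw [(indepFun_iff_map_prod_eq_prod_map_map (hVm.prodMk hξ.aemeasurable)
        (hL.aemeasurable.prodMk hL'.aemeasurable)).1 hpair,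
      (indepFun_iff_map_prod_eq_prod_map_map hVm hξ.aemeasurable).1 hVξ,
      (indepFun_iff_map_prod_eq_prod_map_map hL.aemeasurable hL'.aemeasurable).1 hLL,
      hξ.map_eq, hL.map_eq, hL'.map_eq]
  have hprob : IsProbabilityMeasure (P.map V) := Measure.isProbabilityMeasure_map hVm
  let Φ : (ℝ × ℝ) × (ℝ × ℝ) → ℝ := fun z =>
    z.1.1 ^ a * z.2.1 + (2 * z.1.2 - 1) * (1 - z.1.1) ^ a * z.2.2
  have hΦ : Measurable Φ := by fun_prop
  have hsm : StronglyMeasurable fun z => Complex.exp (t * Φ z * Complex.I) :=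
    (by fun_prop : Measurable _).stronglyMeasurable
  have hν : Measurable (charFun ν) := measurable_charFun
  -- With `V` and `ξ` frozen, independence of `L` and `L'` factorises the exponential; `ξ` and then
  -- `V` are averaged afterwards.
  have hinner : ∀ v x : ℝ, ∫ l, Complex.exp (t * Φ ((v, x), l) * Complex.I) ∂(ν.prod ν) =
      charFun ν (v ^ a * t) * charFun ν ((2 * x - 1) * (1 - v) ^ a * t) := by
    intro v x
    rw [charFun_apply_real, charFun_apply_real, ← integral_prod_mul]
    refine integral_congr_ae (ae_of_all _ fun l => ?_)
    simp only [Φ]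
    rw [← Complex.exp_add]
    push_cast
    ring_nf
  have hmix : Measurable fun z : ℝ × ℝ =>
      charFun ν (z.1 ^ a * t) * charFun ν ((2 * z.2 - 1) * (1 - z.1) ^ a * t) := by
    fun_prop
  calc charFun (P.map fun ω => V ω ^ a * L ω + (2 * ξ ω - 1) * (1 - V ω) ^ a * L' ω) t
      = ∫ z, Complex.exp (t * Φ z * Complex.I)
          ∂(P.map fun ω => ((V ω, ξ ω), (L ω, L' ω))) := by
        rw [show (P.map fun ω => V ω ^ a * L ω + (2 * ξ ω - 1) * (1 - V ω) ^ a * L' ω) =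
            (P.map fun ω => ((V ω, ξ ω), (L ω, L' ω))).map Φ from
          (AEMeasurable.map_map_of_aemeasurable hΦ.aemeasurable hZm).symm, charFun_apply_real,
          integral_map hΦ.aemeasurable (by fun_prop)]
    _ = ∫ z, charFun ν (z.1 ^ a * t) * charFun ν ((2 * z.2 - 1) * (1 - z.1) ^ a * t)
          ∂((P.map V).prod (bernoulliMeasure (1 : ℝ) 0 p)) := by
        rw [hmap, integral_prod _ (.of_bound hsm.aestronglyMeasurable 1
          (ae_of_all _ fun _ => (norm_exp_real_mul_real_mul_I _ _).le))]
        exact integral_congr_ae (ae_of_all _ fun z => hinner z.1 z.2)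
    _ = ∫ v, charFun ν (v ^ a * t) * ((p : ℝ) * charFun ν ((1 - v) ^ a * t) +
          (1 - (p : ℝ)) * charFun ν (-((1 - v) ^ a * t))) ∂(P.map V) := by
        rw [integral_prod _ (.of_bound hmix.aestronglyMeasurable 1 (ae_of_all _ fun z => by
          rw [norm_mul]
          exact mul_le_one₀ (norm_charFun_le_one _) (norm_nonneg _) (norm_charFun_le_one _)))]
        refine integral_congr_ae (ae_of_all _ fun v => ?_)
        simp only [integral_const_mul]
        rw [integral_bernoulliMeasure]
        simp only [Complex.real_smul]
        push_cast
        norm_num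
    _ = _ := by rw [hVlaw, intervalIntegral.integral_of_le zero_le_one]

theorem theorem1 (p : I) (a : ℝ) (ha : a = 2 * (p : ℝ) - 1) (ha' : 1 / 2 < a)
    {Ω : Type*} [MeasurableSpace Ω] (P : Measure Ω) [IsProbabilityMeasure P]
    (X : ℕ → Ω → ℝ) (κ : ℕ → Ω → ℕ) (ε : ℕ → Ω → ℝ) (hX : IsElephantWalk P p 1 X κ ε) :
    (∃ L₁ : Ω → ℝ, Measurable L₁ ∧ IsScalingLimit P X a L₁) ∧
    ∀ L₁ : Ω → ℝ, IsScalingLimit P X a L₁ →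
      ∀ {Ω' : Type*} [MeasurableSpace Ω'] (P' : Measure Ω') [IsProbabilityMeasure P']
        (V ξ L L' : Ω' → ℝ),
        pdf.IsUniform V (Set.Icc 0 1) P' →
        HasLaw ξ (bernoulliMeasure (1 : ℝ) 0 p) P' →
        IdentDistrib L L₁ P' P →
        IdentDistrib L' L₁ P' P →
        iIndepFun ![V, ξ, L, L'] P' →
        IdentDistrib L₁
          (fun ω => V ω ^ a * L ω + (2 * ξ ω - 1) * (1 - V ω) ^ a * L' ω) P P' := by
  refine ⟨hX.exists_isScalingLimit ha ha', ?_⟩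
  intro L₁ hL₁ Ω' _ P' _ V ξ L L' hV hξ hL hL' hind
  have hL₁m := hX.aemeasurable_scalingLimit hL₁
  have hVm : AEMeasurable V P' := hV.aemeasurable (by simp) (by simp)
  have hξm := hξ.aemeasurable
  have hLm := hL.aemeasurable_fst
  have hLm' := hL'.aemeasurable_fst
  have hRm : AEMeasurable
      (fun ω => V ω ^ a * L ω + (2 * ξ ω - 1) * (1 - V ω) ^ a * L' ω) P' := by fun_prop
  refine ⟨hL₁m, hRm, ?_⟩
  have := Measure.isProbabilityMeasure_map hL₁m
  have := Measure.isProbabilityMeasure_map hRm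
  refine Measure.ext_of_charFun (funext fun t => ?_)
  rw [hX.charFun_scalingLimit (by linarith) hL₁ t,
    charFun_uniform_mixture hV hξ ⟨hLm, hL.map_eq⟩ ⟨hLm', hL'.map_eq⟩ hind t]
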